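/- Let $q$ be a prime. A $\mathbb{Z}_q$-order in $M_2(\mathbb{Q}_q)$ is a $\mathbb{Z}_q$-subalgebra that is finitely generated as a $\mathbb{Z}_q$-module and spans $M_2(\mathbb{Q}_q)$ over $\mathbb{Q}_q$. The Bruhat–Tits tree is the graph whose vertices are the maximal orders of $M_2(\mathbb{Q}_q)$, where $\Lambda$ and $\Lambda'$ are adjacent if and only if $[\Lambda:\Lambda\cap\Lambda']=[\Lambda':\Lambda\cap\Lambda']=q$; let $d$ be its graph distance. For a set $P$ of vertices put $d(v,P)=\min_{v'\in P}d(v,v')$ and, for an integer $\ell\ge 0$, $N_\ell(P)=\{v : d(v,P)\le \ell\}$. For an order $\Lambda$ with $\mathbb{Z}_q$-basis $\beta_1,\dots,\beta_4$, the discriminant $\operatorname{disc}(\Lambda)$ is the ideal of $\mathbb{Z}_q$ generated by $\det(\operatorname{tr}(\beta_i\beta_j))_{i,j}$, and the reduced discriminant $\operatorname{discrd}(\Lambda)$ is the ideal with $\operatorname{discrd}(\Lambda)^2=\operatorname{disc}(\Lambda)$; $v_q$ of the ideal $(q^n)$ is $n$. Let $P$ be the set of vertices (maximal orders) along a finite nonbacktracking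 path, possibly consisting of a single vertex, in the Bruhat–Tits tree, let $\ell\ge 0$ be an integer, and let $\tilde\Lambda=\bigcap_{\Lambda\in N_\ell(P)}\Lambda$. Then the set of maximal orders of $M_2(\mathbb{Q}_q)$ containing $\tilde\Lambda$ is exactly $N_\ell(P)$, and $$v_q(\operatorname{discrd}(\tilde\Lambda)) = 3\ell + \#P - 1.$$ -/

import Mathlib

/-- The algebra `M₂(ℚ_q)`. -/
abbrev MatQ (q : ℕ) [Fact q.Prime] : Type := Matrix (Fin 2) (Fin 2) ℚ_[q]

/-- A `ℤ_q`-order in `M₂(ℚ_q)`: a `ℤ_q`-subalgebra that is a full lattice, i.e. finitely generated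
over `ℤ_q` and spanning `M₂(ℚ_q)` over `ℚ_q`. -/
def IsLocalOrder {q : ℕ} [Fact q.Prime] (Λ : Subalgebra ℤ_[q] (MatQ q)) : Prop :=
  Submodule.IsLattice ℚ_[q] (Subalgebra.toSubmodule Λ)

/-- The maximal orders of `M₂(ℚ_q)`: orders that are maximal, under inclusion, among all orders. -/
abbrev MaxOrder (q : ℕ) [Fact q.Prime] : Type :=
  {Λ : Subalgebra ℤ_[q] (MatQ q) // Maximal IsLocalOrder Λ}

/-- The index `[Λ : Λ ∩ Λ']` of additive groups (`0` if it is infinite). -/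
noncomputable def interIndex {q : ℕ} [Fact q.Prime] (Λ Λ' : Subalgebra ℤ_[q] (MatQ q)) : ℕ :=
  (Subalgebra.toSubmodule Λ').toAddSubgroup.relIndex (Subalgebra.toSubmodule Λ).toAddSubgroup

/-- The Bruhat–Tits tree: its vertices are the maximal orders of `M₂(ℚ_q)`, and `Λ`, `Λ'` are
neighbours if and only if `[Λ : Λ ∩ Λ'] = [Λ' : Λ ∩ Λ'] = q`. -/
def bruhatTits (q : ℕ) [Fact q.Prime] : SimpleGraph (MaxOrder q) where
  Adj Λ Λ' := interIndex Λ.1 Λ'.1 = q ∧ interIndex Λ'.1 Λ.1 = q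
  symm := ⟨fun _ _ h => ⟨h.2, h.1⟩⟩
  loopless := ⟨fun Λ h => (Fact.out : q.Prime).one_lt.ne
    ((AddSubgroup.relIndex_self (Subalgebra.toSubmodule Λ.1).toAddSubgroup).symm.trans h.1)⟩

/-- A walk is nonbacktracking if it never returns along the edge that it has just traversed. -/
def IsNonbacktracking {V : Type*} {G : SimpleGraph V} {u v : V} (w : G.Walk u v) : Prop :=
  ∀ i : ℕ, i + 2 ≤ w.length → w.getVert i ≠ w.getVert (i + 2)

/-- The set of vertices along a walk. -/
def vertexSet {V : Type*} {G : SimpleGraph V} {u v : V} (w : G.Walk u v) : Set V :=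
  {x | x ∈ w.support}

/-- The distance from a vertex to a set of vertices, the minimum of the distances to its elements
(`⊤` if none of them can be reached). -/
noncomputable def distToSet {V : Type*} (G : SimpleGraph V) (x : V) (P : Set V) : ℕ∞ :=
  ⨅ y ∈ P, G.edist x y

/-- The `ℓ`-neighborhood `N_ℓ(P) = {x : d(x, P) ≤ ℓ}` of a set of vertices. -/
def nbhd {V : Type*} (G : SimpleGraph V) (ℓ : ℕ) (P : Set V) : Set V :=
  {x | distToSet G x P ≤ (ℓ : ℕ∞)}

/-- The intersection of a set of maximal orders. -/
noncomputable def interOrders {q : ℕ} [Fact q.Prime] (S : Set (MaxOrder q)) : Subalgebra ℤ_[q] (MatQ q) :=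
  ⨅ Λ ∈ S, Λ.1

/-- The discriminant of `Λ`: the ideal of `ℤ_q` generated by `det (trd (βᵢ βⱼ))` for a
`ℤ_q`-basis `β₁, …, β₄` of `Λ`. The reduced trace of `M₂(ℚ_q)` is the matrix trace, and different
bases give the same ideal. -/
noncomputable def discIdeal {q : ℕ} [Fact q.Prime] (Λ : Subalgebra ℤ_[q] (MatQ q)) : Ideal ℤ_[q] :=
  Ideal.span {d : ℤ_[q] | ∃ β : Module.Basis (Fin 4) ℤ_[q] Λ,
    (d : ℚ_[q]) = (Matrix.of fun i j : Fin 4 =>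
      Matrix.trace ((β i : MatQ q) * (β j : MatQ q))).det}

/-- The reduced discriminant of `Λ`: the ideal of `ℤ_q` whose square is the discriminant. There is
at most one such ideal; if there is none, the value is the zero ideal. -/
noncomputable def discrd {q : ℕ} [Fact q.Prime] (Λ : Subalgebra ℤ_[q] (MatQ q)) : Ideal ℤ_[q] :=
  sSup {I : Ideal ℤ_[q] | I ^ 2 = discIdeal Λ}

/-- The `q`-adic valuation of an ideal of `ℤ_q`: the largest `n` such that `(q)ⁿ` divides it
(`⊤` for the zero ideal). -/
noncomputable def idealVal {q : ℕ} [Fact q.Prime] (I : Ideal ℤ_[q]) : ℕ∞ :=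
  emultiplicity (Ideal.span {(q : ℤ_[q])}) I

/-!
A vertex of the Bruhat–Tits tree is the same thing as a closed ball `b + q ^ a ℤ_q` of `ℚ_q`: an
order stabilizes a lattice in `ℚ_q²`, every lattice has up to scaling a basis `(q ^ a, 0)`, `(b, 1)`,
and membership of a matrix in the endomorphism ring of that lattice amounts to four conditions on
its entries (`mem_ballOrder`, `exists_eq_ballVertex`). If `q ^ (-c)` is the radius of the smallest
ball that contains the balls `p` and `p'`, of exponents `a` and `a'`, then the two orders have
distance `gap p p' = a + a' - 2 * c`. Indeed the stabilizer of `M₂(ℤ_q)` moves every vertex onto the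
standard ray of the balls `q ^ i ℤ_q` (`exists_smul_ballOrder_eq_ray`), where one reads off the
index `q ^ gap` of the intersection, so adjacency means `gap = 1`; and `gap` satisfies the triangle
inequality and drops to `0` by repeated enlargement of the balls (`edist_ballVertex_le_iff`).

The ultrametric inequality for `c` shows that a nonbacktracking path is a geodesic
(`gap_succ_of_ne`), and by the Cartan decomposition it is conjugate to a segment `0, …, n` of the
standard ray (`exists_smul_vertexSet_eq`). Everything in the theorem is invariant under conjugation.
For the segment, the intersection over the `ℓ`-neighborhood is `ℤ_q + q ^ ℓ E`, where `E` is the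
Eichler order of the matrices in `M₂(ℤ_q)` with upper right entry in `q ^ n ℤ_q`
(`mem_interOrders_nbhd_ray`). The conditions for `ℤ_q + q ^ ℓ E` to lie in the order of a ball turn
out to be the inequalities that put the ball at distance at most `ℓ` from the segment
(`mem_nbhd_of_interOrders_le`), and the Gram matrix of the evident basis of `ℤ_q + q ^ ℓ E` has
determinant `-q ^ (2 * (3 * ℓ + n))` (`discIdeal_interOrders`).
-/

open scoped Pointwise

/-! ### Fractional ideals of `ℤ_q` -/

section Valuation

variable {q : ℕ} [Fact q.Prime]

/-- `InPow k x` says that `x` lies in the fractional ideal `q ^ k ℤ_q` of `ℚ_q`. -/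
def InPow (k : ℤ) (x : ℚ_[q]) : Prop := ‖x‖ ≤ (q : ℝ) ^ (-k)

namespace InPow

variable {k l : ℤ} {x y : ℚ_[q]}

lemma zero (k : ℤ) : InPow k (0 : ℚ_[q]) := by
  simp only [InPow, norm_zero]; positivity

lemma add (hx : InPow k x) (hy : InPow k y) : InPow k (x + y) :=
  (Padic.nonarchimedean x y).trans (max_le hx hy)

lemma neg (hx : InPow k x) : InPow k (-x) := by rwa [InPow, norm_neg]

lemma sub (hx : InPow k x) (hy : InPow k y) : InPow k (x - y) := by
  rw [sub_eq_add_neg]; exact hx.add hy.neg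

lemma mul (hx : InPow k x) (hy : InPow l y) : InPow (k + l) (x * y) := by
  have hq : (0 : ℝ) < q := by exact_mod_cast (Fact.out : q.Prime).pos
  rw [InPow, norm_mul, neg_add, zpow_add₀ hq.ne']
  exact mul_le_mul hx hy (norm_nonneg _) (by positivity)

lemma mono (hx : InPow k x) (h : l ≤ k) : InPow l x := by
  have hq : (1 : ℝ) ≤ q := by exact_mod_cast (Fact.out : q.Prime).one_lt.le
  exact hx.trans (zpow_le_zpow_right₀ hq (by lia))

lemma mul_of_le {m : ℤ} (hx : InPow k x) (hy : InPow l y) (h : m ≤ k + l) : InPow m (x * y) :=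
  (hx.mul hy).mono h

end InPow

lemma natCast_prime_ne_zero : (q : ℚ_[q]) ≠ 0 := by
  exact_mod_cast (Fact.out : q.Prime).ne_zero

lemma inPow_iff_le_valuation {k : ℤ} {x : ℚ_[q]} (hx : x ≠ 0) :
    InPow k x ↔ k ≤ x.valuation := by
  have hq : (1 : ℝ) < q := by exact_mod_cast (Fact.out : q.Prime).one_lt
  rw [InPow, Padic.norm_eq_zpow_neg_valuation hx, zpow_le_zpow_iff_right₀ hq, neg_le_neg_iff]

lemma inPow_zpow_iff {k l : ℤ} : InPow k ((q : ℚ_[q]) ^ l) ↔ k ≤ l := by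
  rw [inPow_iff_le_valuation (zpow_ne_zero _ natCast_prime_ne_zero)]
  simp

lemma inPow_zpow_mul_iff {k l : ℤ} {x : ℚ_[q]} :
    InPow k ((q : ℚ_[q]) ^ l * x) ↔ InPow (k - l) x := by
  constructor <;> intro h
  · have := (inPow_zpow_iff (q := q).2 (le_refl (-l))).mul h
    rw [← mul_assoc, ← zpow_add₀ natCast_prime_ne_zero] at this
    simpa [sub_eq_neg_add] using this
  · exact (inPow_zpow_iff.2 le_rfl).mul_of_le h (by lia)

lemma inPow_coe (x : ℤ_[q]) : InPow 0 (x : ℚ_[q]) := by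
  simpa [InPow] using x.norm_le_one

lemma inPow_zero_iff {x : ℚ_[q]} : InPow 0 x ↔ ∃ t : ℤ_[q], (t : ℚ_[q]) = x :=
  ⟨fun h => ⟨⟨x, by simpa [InPow] using h⟩, rfl⟩, by rintro ⟨t, rfl⟩; exact inPow_coe t⟩

lemma inPow_one : InPow 0 (1 : ℚ_[q]) := by simp [InPow]

lemma inPow_div {k : ℤ} {x y : ℚ_[q]} (hy : y ≠ 0) (h : InPow (k + y.valuation) x) :
    InPow k (x / y) := by
  rw [div_eq_mul_inv]
  exact h.mul_of_le ((inPow_iff_le_valuation (inv_ne_zero hy)).2 le_rfl) (by simp)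

lemma inPow_pow_iff {k : ℤ} {m : ℕ} : InPow k ((q : ℚ_[q]) ^ m) ↔ k ≤ m := by
  rw [← zpow_natCast, inPow_zpow_iff]

lemma inPow_mul_pow_iff {k : ℤ} {m : ℕ} {x : ℚ_[q]} :
    InPow k (x * (q : ℚ_[q]) ^ m) ↔ InPow (k - m) x := by
  rw [← zpow_natCast, mul_comm, inPow_zpow_mul_iff]

lemma exists_coe_mul_pow {m : ℕ} {x : ℚ_[q]} (h : InPow m x) :
    ∃ t : ℤ_[q], x = t * (q : ℚ_[q]) ^ m := by
  have hq : (q : ℚ_[q]) ^ m ≠ 0 := pow_ne_zero _ natCast_prime_ne_zero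
  obtain ⟨t, ht⟩ := inPow_zero_iff.1 (inPow_div hq (k := 0) (by simpa using h))
  exact ⟨t, by rw [ht, div_mul_cancel₀ _ hq]⟩

end Valuation

/-! ### Conjugation -/

section Action

variable {q : ℕ} [Fact q.Prime]

/-- The group `GL₂(ℚ_q)`, acting on `M₂(ℚ_q)` by conjugation. -/
abbrev ConjGL (q : ℕ) [Fact q.Prime] : Type := ConjAct (MatQ q)ˣ

/-- `GL₂(ℚ_q)` acts on the subalgebras of `M₂(ℚ_q)` by conjugation. -/
noncomputable instance : MulAction (ConjGL q) (Subalgebra ℤ_[q] (MatQ q)) where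
  smul g Λ := Λ.map (MulSemiringAction.toAlgHom ℤ_[q] (MatQ q) g)
  one_smul Λ := (congr_arg (fun f => Λ.map f) (AlgHom.ext <| one_smul (ConjGL q))).trans Λ.map_id
  mul_smul _ _ Λ :=
    (congr_arg (fun f => Λ.map f) (AlgHom.ext <| mul_smul _ _)).trans (Λ.map_map _ _).symm

lemma padicInt_smul_apply (c : ℤ_[q]) (X : MatQ q) (i j : Fin 2) : (c • X) i j = c * X i j := by
  rw [Matrix.smul_apply, Algebra.smul_def]; rfl

lemma mem_conj_smul {g : ConjGL q} {Λ : Subalgebra ℤ_[q] (MatQ q)} {X : MatQ q} :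
    X ∈ g • Λ ↔ g⁻¹ • X ∈ Λ := by
  change X ∈ g • (Λ : Set (MatQ q)) ↔ _
  rw [Set.mem_smul_set_iff_inv_smul_mem]; rfl

lemma conj_smul_mem {g : ConjGL q} {Λ : Subalgebra ℤ_[q] (MatQ q)} {X : MatQ q} :
    g • X ∈ g • Λ ↔ X ∈ Λ := by
  rw [mem_conj_smul, inv_smul_smul]

lemma conj_smul_le {g : ConjGL q} {Λ Λ' : Subalgebra ℤ_[q] (MatQ q)} :
    g • Λ ≤ Λ' ↔ Λ ≤ g⁻¹ • Λ' := by
  constructor <;> intro h X hX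
  · rw [mem_conj_smul, inv_inv]; exact h (conj_smul_mem.2 hX)
  · rw [mem_conj_smul] at hX; simpa [mem_conj_smul] using h hX

lemma conj_smul_le_conj_smul {g : ConjGL q} {Λ Λ' : Subalgebra ℤ_[q] (MatQ q)} :
    g • Λ ≤ g • Λ' ↔ Λ ≤ Λ' := by
  rw [conj_smul_le, inv_smul_smul]

lemma trace_conj_smul (g : ConjGL q) (X : MatQ q) : (g • X).trace = X.trace := by
  rw [ConjAct.units_smul_def, Matrix.trace_mul_cycle]; simp

lemma IsLocalOrder.conj_smul {Λ : Subalgebra ℤ_[q] (MatQ q)} (h : IsLocalOrder Λ) (g : ConjGL q) :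
    IsLocalOrder (g • Λ) := by
  let φ : MatQ q →ₗ[ℚ_[q]] MatQ q := DistribSMul.toLinearMap ℚ_[q] (MatQ q) g
  have hφ : ((Subalgebra.toSubmodule (g • Λ) : Submodule ℤ_[q] (MatQ q)) : Set (MatQ q)) =
      φ '' (Λ : Set (MatQ q)) := rfl
  constructor
  · have hmap : Subalgebra.toSubmodule (g • Λ) = (Subalgebra.toSubmodule Λ).map
        (DistribSMul.toLinearMap ℤ_[q] (MatQ q) g) := rfl
    rw [hmap]
    exact h.fg.map _
  · rw [hφ, Submodule.span_image]
    have h2 := h.span_eq_top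
    change Submodule.span _ (Λ : Set (MatQ q)) = ⊤ at h2
    rw [h2, Submodule.map_top, LinearMap.range_eq_top]
    exact MulAction.surjective g

lemma maximal_conj_smul {Λ : Subalgebra ℤ_[q] (MatQ q)} (h : Maximal IsLocalOrder Λ)
    (g : ConjGL q) :
    Maximal IsLocalOrder (g • Λ) := by
  refine ⟨h.1.conj_smul g, fun Λ' h' hle => ?_⟩
  rw [conj_smul_le] at hle
  have := h.2 (h'.conj_smul g⁻¹) hle
  rwa [conj_smul_le, inv_inv] at this

/-- `GL₂(ℚ_q)` acts on the vertices of the Bruhat–Tits tree by conjugation. -/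
noncomputable instance : MulAction (ConjGL q) (MaxOrder q) where
  smul g Λ := ⟨g • Λ.1, maximal_conj_smul Λ.2 g⟩
  one_smul Λ := Subtype.ext (one_smul _ Λ.1)
  mul_smul g h Λ := Subtype.ext (mul_smul g h Λ.1)

lemma coe_conj_smul (g : ConjGL q) (Λ : MaxOrder q) : (g • Λ).1 = g • Λ.1 := rfl

lemma interIndex_conj_smul (g : ConjGL q) (Λ Λ' : Subalgebra ℤ_[q] (MatQ q)) :
    interIndex (g • Λ) (g • Λ') = interIndex Λ Λ' := by
  have hmap (Λ : Subalgebra ℤ_[q] (MatQ q)) : (Subalgebra.toSubmodule (g • Λ)).toAddSubgroup =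
      (Subalgebra.toSubmodule Λ).toAddSubgroup.map (DistribSMul.toAddMonoidHom (MatQ q) g) :=
    SetLike.coe_injective rfl
  rw [interIndex, hmap, hmap]
  exact AddSubgroup.relIndex_map_map_of_injective _ _ (MulAction.injective g)

lemma interOrders_conj_smul (g : ConjGL q) (S : Set (MaxOrder q)) :
    interOrders (g • S) = g • interOrders S := by
  ext X
  simp only [interOrders, mem_conj_smul, Algebra.mem_iInf]
  constructor
  · intro h Λ hΛ
    exact mem_conj_smul.1 (h (g • Λ) (Set.smul_mem_smul_set hΛ))
  · rintro h _ ⟨Λ, hΛ, rfl⟩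
    exact mem_conj_smul.2 (h Λ hΛ)

lemma discIdeal_le_conj_smul (g : ConjGL q) (Λ : Subalgebra ℤ_[q] (MatQ q)) :
    discIdeal Λ ≤ discIdeal (g • Λ) := by
  refine Ideal.span_mono ?_
  rintro d ⟨β, hd⟩
  let φ : MatQ q →ₗ[ℤ_[q]] MatQ q := DistribSMul.toLinearMap ℤ_[q] (MatQ q) g
  have hφ : (Subalgebra.toSubmodule Λ).map φ = Subalgebra.toSubmodule (g • Λ) := rfl
  let e : Λ ≃ₗ[ℤ_[q]] (g • Λ : Subalgebra ℤ_[q] (MatQ q)) :=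
    (Submodule.equivMapOfInjective φ (MulAction.injective g) (Subalgebra.toSubmodule Λ)).trans
      (LinearEquiv.ofEq _ _ hφ)
  have he (x : Λ) : (e x : MatQ q) = g • (x : MatQ q) := rfl
  refine ⟨β.map e, ?_⟩
  simp only [Module.Basis.map_apply, he, ← smul_mul', trace_conj_smul]
  exact hd

lemma discrd_conj_smul (g : ConjGL q) (Λ : Subalgebra ℤ_[q] (MatQ q)) :
    discrd (g • Λ) = discrd Λ := by
  have : discIdeal (g • Λ) = discIdeal Λ :=
    le_antisymm (by simpa using discIdeal_le_conj_smul g⁻¹ (g • Λ)) (discIdeal_le_conj_smul g Λ)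
  rw [discrd, discrd, this]

end Action

/-! ### Orders attached to balls -/

section BallOrders

variable {q : ℕ} [Fact q.Prime]

/-- The order `M₂(ℤ_q)`. -/
def intOrder (q : ℕ) [Fact q.Prime] : Subalgebra ℤ_[q] (MatQ q) where
  carrier := {X | ∀ i j, InPow 0 (X i j)}
  mul_mem' {X Y} hX hY i j := by
    rw [Matrix.mul_apply, Fin.sum_univ_two]
    exact ((hX _ _).mul (hY _ _)).add ((hX _ _).mul (hY _ _))
  add_mem' {X Y} hX hY i j := (hX i j).add (hY i j)
  algebraMap_mem' r i j := by
    rw [Matrix.algebraMap_matrix_apply]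
    split_ifs
    · exact inPow_coe r
    · exact InPow.zero _

lemma mem_intOrder {X : MatQ q} : X ∈ intOrder q ↔ ∀ i j, InPow 0 (X i j) := Iff.rfl

/-- A closed ball `ctr + q ^ exp ℤ_q` in `ℚ_q`, with a chosen center. Different centers of one ball
give different terms, but the same order. -/
structure PadicBall (q : ℕ) [Fact q.Prime] where
  /-- The radius of the ball is `q ^ (-exp)`. -/
  exp : ℤ
  /-- The center of the ball. -/
  ctr : ℚ_[q]

/-- The affine map `t ↦ q ^ exp * t + ctr` that takes `ℤ_q` onto the ball, as a matrix. -/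
noncomputable def affUnit (p : PadicBall q) : (MatQ q)ˣ where
  val := !![(q : ℚ_[q]) ^ p.exp, p.ctr; 0, 1]
  inv := !![(q : ℚ_[q]) ^ (-p.exp), -(q : ℚ_[q]) ^ (-p.exp) * p.ctr; 0, 1]
  val_inv := by
    have h : (q : ℚ_[q]) ^ p.exp ≠ 0 := zpow_ne_zero _ natCast_prime_ne_zero
    ext i j; fin_cases i <;> fin_cases j <;> simp [Matrix.mul_apply, h]
  inv_val := by
    have h : (q : ℚ_[q]) ^ p.exp ≠ 0 := zpow_ne_zero _ natCast_prime_ne_zero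
    ext i j; fin_cases i <;> fin_cases j <;> simp [Matrix.mul_apply, h]

/-- The conjugation by `affUnit p`. -/
noncomputable def affConj (p : PadicBall q) : ConjGL q := ConjAct.toConjAct (affUnit p)

/-- The maximal order attached to the ball `b + q ^ a ℤ_q`: the endomorphism ring of the lattice
spanned by `(q ^ a, 0)` and `(b, 1)`. -/
noncomputable def ballOrder (p : PadicBall q) : Subalgebra ℤ_[q] (MatQ q) :=
  affConj p • intOrder q

lemma mem_ballOrder {p : PadicBall q} {X : MatQ q} : X ∈ ballOrder p ↔
    InPow 0 (X 0 0 - p.ctr * X 1 0) ∧ InPow 0 (X 1 1 + p.ctr * X 1 0) ∧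
      InPow (-p.exp) (X 1 0) ∧
      InPow p.exp (X 0 1 + p.ctr * (X 0 0 - X 1 1) - p.ctr ^ 2 * X 1 0) := by
  have h : (q : ℚ_[q]) ^ p.exp ≠ 0 := zpow_ne_zero _ natCast_prime_ne_zero
  have key : (affConj p)⁻¹ • X = !![X 0 0 - p.ctr * X 1 0,
      (q : ℚ_[q]) ^ (-p.exp) * (X 0 1 + p.ctr * (X 0 0 - X 1 1) - p.ctr ^ 2 * X 1 0);
      (q : ℚ_[q]) ^ p.exp * X 1 0, X 1 1 + p.ctr * X 1 0] := by
    change !![(q : ℚ_[q]) ^ (-p.exp), -(q : ℚ_[q]) ^ (-p.exp) * p.ctr; 0, 1] * X *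
      !![(q : ℚ_[q]) ^ p.exp, p.ctr; 0, 1] = _
    ext i j
    simp only [Matrix.mul_apply, Fin.sum_univ_two]
    fin_cases i <;> fin_cases j <;> simp <;> field_simp <;> ring
  rw [ballOrder, mem_conj_smul, key, mem_intOrder]
  simp [Fin.forall_fin_two, inPow_zpow_mul_iff, -zpow_neg]
  tauto

lemma affUnit_mul (p p' : PadicBall q) : affUnit p *
    affUnit ⟨p'.exp - p.exp, (q : ℚ_[q]) ^ (-p.exp) * (p'.ctr - p.ctr)⟩ = affUnit p' := by
  have h : (q : ℚ_[q]) ^ p.exp ≠ 0 := zpow_ne_zero _ natCast_prime_ne_zero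
  refine Units.ext ?_
  rw [Units.val_mul]
  ext i j
  fin_cases i <;> fin_cases j <;>
    simp [affUnit, Matrix.mul_apply, Fin.sum_univ_two,
      ← zpow_add₀ (natCast_prime_ne_zero (q := q)), h]

lemma affConj_inv_smul_ballOrder (p p' : PadicBall q) :
    (affConj p)⁻¹ • ballOrder p' =
      ballOrder ⟨p'.exp - p.exp, (q : ℚ_[q]) ^ (-p.exp) * (p'.ctr - p.ctr)⟩ := by
  rw [ballOrder, ballOrder, inv_smul_eq_iff, ← mul_smul, affConj, affConj, affConj,
    ← ConjAct.toConjAct_mul, affUnit_mul]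

lemma ballOrder_zero : ballOrder (⟨0, 0⟩ : PadicBall q) = intOrder q := by
  ext X
  simp [mem_ballOrder, mem_intOrder, Fin.forall_fin_two]
  tauto

lemma isLocalOrder_intOrder : IsLocalOrder (intOrder q) := by
  constructor
  · let f : Matrix (Fin 2) (Fin 2) ℤ_[q] →ₗ[ℤ_[q]] MatQ q :=
      (Algebra.linearMap ℤ_[q] ℚ_[q]).mapMatrix
    have : Subalgebra.toSubmodule (intOrder q) = LinearMap.range f := by
      ext X
      rw [Subalgebra.mem_toSubmodule, mem_intOrder]
      constructor
      · intro h
        choose Y hY using fun i j => inPow_zero_iff.1 (h i j)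
        exact ⟨Matrix.of Y, by ext i j; exact hY i j⟩
      · rintro ⟨Y, rfl⟩ i j
        exact inPow_coe (Y i j)
    rw [this]
    exact Module.Finite.iff_fg.1 (Module.Finite.range f)
  · rw [eq_top_iff]
    intro X _
    rw [Matrix.matrix_eq_sum_single X]
    refine Submodule.sum_mem _ fun i _ => Submodule.sum_mem _ fun j _ => ?_
    have : Matrix.single i j (X i j) = X i j • Matrix.single i j (1 : ℚ_[q]) := by
      rw [Matrix.smul_single, smul_eq_mul, mul_one]
    rw [this]
    refine Submodule.smul_mem _ _ (Submodule.subset_span ?_)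
    intro k l
    rw [Matrix.single_apply]
    split_ifs
    · exact inPow_one
    · exact InPow.zero _

lemma exists_inPow (x : ℚ_[q]) : ∃ k : ℤ, InPow k x := by
  by_cases hx : x = 0
  · exact ⟨0, hx ▸ InPow.zero 0⟩
  · exact ⟨_, (inPow_iff_le_valuation hx).2 le_rfl⟩

/-- The entries of the elements of a finitely generated module of matrices are bounded. -/
lemma exists_inPow_of_fg {M : Submodule ℤ_[q] (MatQ q)} (hM : M.FG) :
    ∃ N : ℤ, ∀ X ∈ M, ∀ i j, InPow N (X i j) := by
  refine Submodule.fg_induction (R := ℤ_[q]) (M := MatQ q)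
    (motive := fun M _ => ∃ N : ℤ, ∀ X ∈ M, ∀ i j, InPow N (X i j)) ?_ ?_ M hM
  · intro X
    choose k hk using fun ij : Fin 2 × Fin 2 => exists_inPow (X ij.1 ij.2)
    refine ⟨Finset.univ.inf' ⟨(0, 0), Finset.mem_univ _⟩ k, fun Y hY i j => ?_⟩
    obtain ⟨t, rfl⟩ := Submodule.mem_span_singleton.1 hY
    exact (inPow_coe t).mul_of_le (hk (i, j)) (by
      rw [zero_add]; exact Finset.inf'_le k (Finset.mem_univ (i, j)))
  · rintro M₁ M₂ - - ⟨N₁, h₁⟩ ⟨N₂, h₂⟩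
    refine ⟨min N₁ N₂, fun X hX i j => ?_⟩
    obtain ⟨Y, hY, Z, hZ, rfl⟩ := Submodule.mem_sup.1 hX
    exact ((h₁ Y hY i j).mono (min_le_left _ _)).add ((h₂ Z hZ i j).mono (min_le_right _ _))

/-- A bounded nonzero set of `q`-adic numbers has a nonzero element of least valuation. -/
lemma exists_valuation_min {T : ℚ_[q] → Prop} {N : ℤ} (h1 : T 1) (hN : ∀ x, T x → InPow N x) :
    ∃ t, T t ∧ t ≠ 0 ∧ ∀ x, T x → InPow t.valuation x := by
  obtain ⟨k, ⟨t, ht, ht0, rfl⟩, hk⟩ := Int.exists_least_of_bdd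
    (P := fun k => ∃ t, T t ∧ t ≠ 0 ∧ t.valuation = k)
    ⟨N, by rintro _ ⟨t, ht, ht0, rfl⟩; exact (inPow_iff_le_valuation ht0).1 (hN t ht)⟩
    ⟨_, 1, h1, one_ne_zero, rfl⟩
  refine ⟨t, ht, ht0, fun x hx => ?_⟩
  by_cases hx0 : x = 0
  · exact hx0 ▸ InPow.zero _
  · exact (inPow_iff_le_valuation hx0).2 (hk _ ⟨x, hx, hx0, rfl⟩)

/-- Every order stabilizes a lattice in `ℚ_q²`, here the one generated by the columns of its
elements, and a lattice has, up to scaling, a basis of the form `(q ^ a, 0)`, `(b, 1)`. -/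
lemma exists_le_ballOrder {Λ : Subalgebra ℤ_[q] (MatQ q)} (hΛ : IsLocalOrder Λ) :
    ∃ p : PadicBall q, Λ ≤ ballOrder p := by
  obtain ⟨N, hN⟩ := exists_inPow_of_fg hΛ.fg
  -- `L s t` says that `(s, t)` is in the lattice generated by the columns of elements of `Λ`.
  let L (s t : ℚ_[q]) : Prop := ∃ X ∈ Λ, ∃ Y ∈ Λ, s = X 0 0 + Y 0 1 ∧ t = X 1 0 + Y 1 1
  have hLN {s t : ℚ_[q]} (h : L s t) : InPow N s ∧ InPow N t := by
    obtain ⟨X, hX, Y, hY, rfl, rfl⟩ := h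
    exact ⟨(hN X hX _ _).add (hN Y hY _ _), (hN X hX _ _).add (hN Y hY _ _)⟩
  have hLmul {s t : ℚ_[q]} (h : L s t) {Z : MatQ q} (hZ : Z ∈ Λ) :
      L (Z 0 0 * s + Z 0 1 * t) (Z 1 0 * s + Z 1 1 * t) := by
    obtain ⟨X, hX, Y, hY, rfl, rfl⟩ := h
    refine ⟨Z * X, mul_mem hZ hX, Z * Y, mul_mem hZ hY, ?_, ?_⟩ <;>
      simp only [Matrix.mul_apply, Fin.sum_univ_two] <;> ring
  have hLsub {s t s' t' c : ℚ_[q]} (h : L s t) (h' : L s' t') (hc : InPow 0 c) :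
      L (s - c * s') (t - c * t') := by
    obtain ⟨c, rfl⟩ := inPow_zero_iff.1 hc
    obtain ⟨X, hX, Y, hY, rfl, rfl⟩ := h
    obtain ⟨X', hX', Y', hY', rfl, rfl⟩ := h'
    refine ⟨X - c • X', sub_mem hX (Λ.smul_mem hX' c), Y - c • Y',
      sub_mem hY (Λ.smul_mem hY' c), ?_, ?_⟩ <;>
      simp only [Matrix.sub_apply, padicInt_smul_apply] <;> ring
  have hL10 : L 1 0 := ⟨1, one_mem Λ, 0, zero_mem Λ, by simp, by simp⟩
  have hL01 : L 0 1 := ⟨0, zero_mem Λ, 1, one_mem Λ, by simp, by simp⟩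
  obtain ⟨v, ⟨u, huv⟩, hv0, hv⟩ := exists_valuation_min (T := fun t => ∃ s, L s t) ⟨0, hL01⟩
    (fun t ⟨s, h⟩ => (hLN h).2)
  obtain ⟨w, hw, hw0, hwmin⟩ := exists_valuation_min (T := fun s => L s 0) hL10
    (fun s h => (hLN h).1)
  -- `(u, v)` and `(w, 0)` form a basis of the lattice, by the minimality of `v` and `w`.
  have hdiv {s t : ℚ_[q]} (h : L s t) : InPow 0 (t / v) :=
    inPow_div hv0 (by simpa using hv t ⟨s, h⟩)
  have hred {s t : ℚ_[q]} (h : L s t) : InPow w.valuation (s - t / v * u) := by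
    refine hwmin _ ?_
    have := hLsub h huv (hdiv h)
    rwa [div_mul_cancel₀ _ hv0, sub_self] at this
  have hval (x : ℚ_[q]) {k : ℤ} (y : ℚ_[q]) (hy : y ≠ 0) (h : InPow (k + y.valuation) (y * x)) :
      InPow k x := by
    have := inPow_div hy h
    rwa [mul_div_cancel_left₀ _ hy] at this
  refine ⟨⟨w.valuation - v.valuation, u / v⟩, fun X hX => mem_ballOrder.2 ?_⟩
  have h1 := hLmul hw hX
  have h2 := hLmul huv hX
  refine ⟨hval _ w hw0 ?_, ?_, ?_, hval _ v hv0 ?_⟩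
  · convert hred h1 using 1
    · ring
    · field_simp; ring
  · convert hdiv h2 using 1
    field_simp; ring
  · refine hval _ w hw0 (hval _ v⁻¹ (inv_ne_zero hv0) ?_)
    convert hdiv h1 using 1
    · simp
    · field_simp; ring
  · convert hred h2 using 1
    · ring
    · field_simp; ring

end BallOrders

/-! ### Maximal orders are the orders of balls -/

section Maximality

variable {q : ℕ} [Fact q.Prime]

lemma ballOrder_le_of_ctr {a : ℤ} {b b' : ℚ_[q]} (h : InPow a (b' - b)) :
    ballOrder ⟨a, b⟩ ≤ ballOrder ⟨a, b'⟩ := by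
  intro X hX
  obtain ⟨h1, h2, h3, h4⟩ := mem_ballOrder.1 hX
  have h5 : InPow 0 ((b' - b) * X 1 0) := h.mul_of_le h3 (by simp)
  refine mem_ballOrder.2 ⟨?_, ?_, h3, ?_⟩
  · convert h1.sub h5 using 1; ring
  · convert h2.add h5 using 1; ring
  · convert (h4.add (h.mul_of_le (h1.sub h2) (add_zero _).ge)).sub
      (h.mul_of_le h5 (add_zero _).ge) using 1
    ring

lemma ballOrder_congr {p p' : PadicBall q} (hexp : p.exp = p'.exp)
    (hctr : InPow p.exp (p.ctr - p'.ctr)) : ballOrder p = ballOrder p' := by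
  obtain ⟨a, b⟩ := p
  obtain ⟨a', b'⟩ := p'
  obtain rfl : a = a' := hexp
  exact le_antisymm (ballOrder_le_of_ctr (by simpa using hctr.neg)) (ballOrder_le_of_ctr hctr)

lemma eq_of_intOrder_le_ballOrder {p : PadicBall q} (h : intOrder q ≤ ballOrder p) :
    ballOrder p = intOrder q := by
  have hsingle (i j : Fin 2) : Matrix.single i j (1 : ℚ_[q]) ∈ intOrder q := fun k l => by
    rw [Matrix.single_apply]
    split_ifs
    · exact inPow_one
    · exact InPow.zero _
  have h1 := (mem_ballOrder.1 (h (hsingle 0 1))).2.2.2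
  have h2 := (mem_ballOrder.1 (h (hsingle 1 0))).2.2.1
  have h3 := (mem_ballOrder.1 (h (hsingle 0 0))).2.2.2
  simp at h1 h2 h3
  rw [← zpow_zero (q : ℚ_[q]), inPow_zpow_iff] at h1 h2
  rw [← ballOrder_zero]
  exact ballOrder_congr (by simp; lia) (by simpa using h3)

lemma maximal_intOrder : Maximal IsLocalOrder (intOrder q) := by
  refine ⟨isLocalOrder_intOrder, fun Λ hΛ hle => ?_⟩
  obtain ⟨p, hp⟩ := exists_le_ballOrder hΛ
  rwa [eq_of_intOrder_le_ballOrder (hle.trans hp)] at hp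

lemma maximal_ballOrder (p : PadicBall q) : Maximal IsLocalOrder (ballOrder p) :=
  maximal_conj_smul maximal_intOrder _

/-- The vertex of the Bruhat–Tits tree attached to a ball. -/
noncomputable def ballVertex (p : PadicBall q) : MaxOrder q := ⟨ballOrder p, maximal_ballOrder p⟩

lemma exists_eq_ballVertex (x : MaxOrder q) : ∃ p, x = ballVertex p := by
  obtain ⟨p, hp⟩ := exists_le_ballOrder x.2.1
  exact ⟨p, Subtype.ext (x.2.eq_of_le (maximal_ballOrder p).1 hp)⟩

end Maximality

/-! ### The tree of balls -/

section Confluence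

variable {q : ℕ} [Fact q.Prime]

open Classical in
/-- The exponent of the smallest ball that contains both `p` and `p'`. The valuation is taken only
of a nonzero number: if the centers agree, the first case applies. -/
noncomputable def conf (p p' : PadicBall q) : ℤ :=
  if InPow (min p.exp p'.exp) (p.ctr - p'.ctr) then min p.exp p'.exp
  else (p.ctr - p'.ctr).valuation

lemma le_conf_iff {p p' : PadicBall q} {k : ℤ} :
    k ≤ conf p p' ↔ k ≤ p.exp ∧ k ≤ p'.exp ∧ InPow k (p.ctr - p'.ctr) := by
  rw [conf]
  split_ifs with h
  · rw [le_min_iff]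
    exact ⟨fun hk => ⟨hk.1, hk.2, h.mono (le_min hk.1 hk.2)⟩, fun hk => ⟨hk.1, hk.2.1⟩⟩
  · have h0 : p.ctr - p'.ctr ≠ 0 := fun h0 => h (h0 ▸ InPow.zero _)
    rw [inPow_iff_le_valuation h0] at h ⊢
    rw [not_le, lt_min_iff] at h
    exact ⟨fun hk => ⟨by lia, by lia, hk⟩, fun hk => hk.2.2⟩

lemma conf_le_left (p p' : PadicBall q) : conf p p' ≤ p.exp := (le_conf_iff.1 le_rfl).1

lemma conf_le_right (p p' : PadicBall q) : conf p p' ≤ p'.exp := (le_conf_iff.1 le_rfl).2.1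

lemma conf_comm (p p' : PadicBall q) : conf p p' = conf p' p := by
  have h (p p' : PadicBall q) : conf p p' ≤ conf p' p :=
    le_conf_iff.2 ⟨conf_le_right _ _, conf_le_left _ _, by
      simpa using ((le_conf_iff (p := p) (p' := p')).1 le_rfl).2.2.neg⟩
  exact le_antisymm (h _ _) (h _ _)

lemma min_conf_le (p₁ p₂ p₃ : PadicBall q) : min (conf p₁ p₂) (conf p₂ p₃) ≤ conf p₁ p₃ := by
  have h₁ := (le_conf_iff (p := p₁) (p' := p₂)).1 (min_le_left _ (conf p₂ p₃))
  have h₂ := (le_conf_iff (p := p₂) (p' := p₃)).1 (min_le_right (conf p₁ p₂) _)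
  exact le_conf_iff.2 ⟨h₁.1, h₂.2.1, by simpa using h₁.2.2.add h₂.2.2⟩

/-- The distance between the vertices attached to two balls, as an integer. -/
noncomputable def gap (p p' : PadicBall q) : ℤ := p.exp + p'.exp - 2 * conf p p'

lemma gap_nonneg (p p' : PadicBall q) : 0 ≤ gap p p' := by
  have := conf_le_left p p'; have := conf_le_right p p'; rw [gap]; lia

lemma gap_comm (p p' : PadicBall q) : gap p p' = gap p' p := by
  rw [gap, gap, conf_comm]; ring

lemma gap_triangle (p₁ p₂ p₃ : PadicBall q) : gap p₁ p₃ ≤ gap p₁ p₂ + gap p₂ p₃ := by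
  have := min_conf_le p₁ p₂ p₃
  have := conf_le_right p₁ p₂
  have := conf_le_left p₂ p₃
  simp only [gap]; lia

lemma ballVertex_eq_of_gap_eq_zero {p p' : PadicBall q} (h : gap p p' = 0) :
    ballVertex p = ballVertex p' := by
  have h1 := conf_le_left p p'
  have h2 := conf_le_right p p'
  have h3 := ((le_conf_iff (p := p) (p' := p')).1 le_rfl).2.2
  rw [gap] at h
  exact Subtype.ext (ballOrder_congr (by lia) (h3.mono (by lia)))

lemma conf_eq {p p' : PadicBall q} {c : ℤ}
    (h : ∀ k, k ≤ p.exp ∧ k ≤ p'.exp ∧ InPow k (p.ctr - p'.ctr) ↔ k ≤ c) : conf p p' = c :=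
  eq_of_forall_le_iff fun k => le_conf_iff.trans (h k)

/-- Relative position is invariant under the affine map that takes `ℤ_q` to `p`. -/
lemma gap_relative (p p' : PadicBall q) :
    gap ⟨0, 0⟩ ⟨p'.exp - p.exp, (q : ℚ_[q]) ^ (-p.exp) * (p'.ctr - p.ctr)⟩ = gap p p' := by
  have : conf ⟨0, 0⟩ ⟨p'.exp - p.exp, (q : ℚ_[q]) ^ (-p.exp) * (p'.ctr - p.ctr)⟩ =
      conf p p' - p.exp := by
    refine conf_eq fun k => ?_
    have h : (0 : ℚ_[q]) - (q : ℚ_[q]) ^ (-p.exp) * (p'.ctr - p.ctr) =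
        (q : ℚ_[q]) ^ (-p.exp) * (p.ctr - p'.ctr) := by ring
    rw [h, inPow_zpow_mul_iff, sub_neg_eq_add, le_sub_iff_add_le, le_sub_iff_add_le, le_conf_iff,
      add_le_iff_nonpos_left]
  simp only [gap, this]; ring

end Confluence

/-! ### The Cartan decomposition and indices -/

section Cartan

variable {q : ℕ} [Fact q.Prime]

lemma conj_smul_intOrder {u : (MatQ q)ˣ} (hu : (u : MatQ q) ∈ intOrder q)
    (hu' : ((u⁻¹ : (MatQ q)ˣ) : MatQ q) ∈ intOrder q) :
    ConjAct.toConjAct u • intOrder q = intOrder q := by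
  refine le_antisymm ?_ ?_
  · rw [conj_smul_le]
    intro X hX
    rw [mem_conj_smul, inv_inv]
    exact mul_mem (mul_mem hu hX) hu'
  · intro X hX
    rw [mem_conj_smul]
    have := mul_mem (mul_mem hu' hX) hu
    simpa [ConjAct.units_smul_def] using this

/-- By maximality, one inclusion suffices to compare conjugates of orders of balls. -/
lemma conj_smul_ballOrder_eq_of_le {g : ConjGL q} {p p' : PadicBall q}
    (h : ∀ X ∈ ballOrder p, g • X ∈ ballOrder p') : g • ballOrder p = ballOrder p' := by
  refine (maximal_conj_smul (maximal_ballOrder p) g).eq_of_le (maximal_ballOrder p').1 ?_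
  rw [conj_smul_le]
  intro X hX
  rw [mem_conj_smul, inv_inv]
  exact h X hX

/-- The coordinate swap. -/
noncomputable def swapUnit (q : ℕ) [Fact q.Prime] : (MatQ q)ˣ where
  val := !![0, 1; 1, 0]
  inv := !![0, 1; 1, 0]
  val_inv := by simp [Matrix.one_fin_two]
  inv_val := by simp [Matrix.one_fin_two]

lemma swap_smul_ballOrder (a : ℤ) :
    ConjAct.toConjAct (swapUnit q) • ballOrder ⟨a, 0⟩ = ballOrder (⟨-a, 0⟩ : PadicBall q) := by
  refine conj_smul_ballOrder_eq_of_le fun X hX => ?_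
  have key : ConjAct.toConjAct (swapUnit q) • X = !![X 1 1, X 1 0; X 0 1, X 0 0] := by
    change !![0, 1; 1, 0] * X * !![0, 1; 1, 0] = _
    ext i j
    simp only [Matrix.mul_apply, Fin.sum_univ_two]
    fin_cases i <;> fin_cases j <;> simp
  rw [key]
  simpa [mem_ballOrder, and_comm, and_left_comm, and_assoc] using mem_ballOrder.1 hX

/-- The matrix `!![-t, 1; 1, 0]`, a shear followed by the coordinate swap. -/
noncomputable def shearUnit (t : ℚ_[q]) : (MatQ q)ˣ where
  val := !![-t, 1; 1, 0]
  inv := !![0, 1; 1, t]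
  val_inv := by simp [Matrix.one_fin_two]
  inv_val := by simp [Matrix.one_fin_two]

/-- If `|b|` is at least the radius of the ball `b + q ^ a ℤ_q`, the shear with parameter
`b⁻¹` makes the lattice spanned by `(q ^ a, 0)` and `(b, 1)` diagonal. -/
lemma shear_smul_ballOrder {a : ℤ} {b : ℚ_[q]} (hb : b ≠ 0) (hab : b.valuation ≤ a) :
    ConjAct.toConjAct (shearUnit b⁻¹) • ballOrder ⟨a, b⟩ =
      ballOrder ⟨a - 2 * b.valuation, 0⟩ := by
  refine conj_smul_ballOrder_eq_of_le fun X hX => ?_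
  have key : ConjAct.toConjAct (shearUnit b⁻¹) • X =
      !![X 1 1 - b⁻¹ * X 0 1, X 1 0 + b⁻¹ * (X 1 1 - X 0 0) - b⁻¹ ^ 2 * X 0 1;
        X 0 1, X 0 0 + b⁻¹ * X 0 1] := by
    change !![-b⁻¹, 1; 1, 0] * X * !![0, 1; 1, b⁻¹] = _
    ext i j
    simp only [Matrix.mul_apply, Fin.sum_univ_two]
    fin_cases i <;> fin_cases j <;> simp <;> ring
  rw [key]
  obtain ⟨h1, h2, h3, h4⟩ := mem_ballOrder.1 hX
  dsimp only at h1 h2 h3 h4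
  have hv : InPow b.valuation b := (inPow_iff_le_valuation hb).2 le_rfl
  have hv' : InPow (-b.valuation) b⁻¹ := (inPow_iff_le_valuation (inv_ne_zero hb)).2 (by simp)
  set A := X 0 0 - b * X 1 0 with hA
  set B := X 1 1 + b * X 1 0 with hB
  set C := X 0 1 + b * (X 0 0 - X 1 1) - b ^ 2 * X 1 0 with hC
  have h5 : InPow 0 (b⁻¹ * C) := hv'.mul_of_le h4 (by lia)
  refine mem_ballOrder.2 ⟨?_, ?_, ?_, ?_⟩
  · convert h1.sub h5 using 1
    simp [hA, hC]; field_simp; ring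
  · convert h2.add h5 using 1
    simp [hB, hC]; field_simp; ring
  · convert ((h4.mono (l := -(a - 2 * b.valuation)) (by lia)).sub
      (hv.mul_of_le (h1.sub h2) (by lia))).sub
      ((hv.mul hv).mul_of_le h3 (by lia)) using 1
    simp [hA, hB, hC]; ring
  · convert (hv'.mul hv').neg.mul_of_le h4 (m := a - 2 * b.valuation) (by lia) using 1
    simp [hC]; field_simp; ring

/-- The Cartan decomposition: the stabilizer of `M₂(ℤ_q)` moves every vertex onto the standard
ray. -/
lemma exists_smul_ballOrder_eq_ray (p : PadicBall q) : ∃ g : ConjGL q,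
    g • intOrder q = intOrder q ∧ g • ballOrder p = ballOrder ⟨gap ⟨0, 0⟩ p, 0⟩ := by
  obtain ⟨a, b⟩ := p
  have hswap : ConjAct.toConjAct (swapUnit q) • intOrder q = intOrder q := by
    simpa [ballOrder_zero] using swap_smul_ballOrder (q := q) 0
  -- `h` says that one of the balls `ℤ_q` and `b + q ^ a ℤ_q` contains the other.
  by_cases h : InPow (min 0 a) b
  · rcases le_total 0 a with ha | ha
    · rw [min_eq_left ha] at h
      refine ⟨(affConj ⟨0, b⟩)⁻¹, ?_, ?_⟩
      · rw [inv_smul_eq_iff]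
        refine (conj_smul_intOrder ?_ ?_).symm <;> intro i j <;> fin_cases i <;> fin_cases j <;>
          simp [affUnit, h, h.neg, inPow_one, InPow.zero]
      · have : gap ⟨0, 0⟩ ⟨a, b⟩ = a := by
          rw [gap, conf_eq (c := 0)]
          · simp
          · exact fun k => ⟨fun hk => hk.1, fun hk => ⟨hk, hk.trans ha, by
              simpa using h.neg.mono hk⟩⟩
        rw [affConj_inv_smul_ballOrder, this]
        simp
    · rw [min_eq_right ha] at h
      refine ⟨_, hswap, ?_⟩
      have : gap ⟨0, 0⟩ ⟨a, b⟩ = -a := by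
        rw [gap, conf_eq (c := a)]
        · simp; ring
        · exact fun k => ⟨fun hk => hk.2.1, fun hk => ⟨hk.trans ha, hk, by
            simpa using h.neg.mono hk⟩⟩
      rw [this, ← swap_smul_ballOrder, ballOrder_congr (p := ⟨a, b⟩) (p' := ⟨a, 0⟩) rfl
        (by simpa using h)]
  · have hb : b ≠ 0 := fun hb => h (hb ▸ InPow.zero _)
    rw [inPow_iff_le_valuation hb, not_le, lt_min_iff] at h
    refine ⟨ConjAct.toConjAct (shearUnit b⁻¹), ?_, ?_⟩
    · have hv : InPow 0 b⁻¹ := (inPow_iff_le_valuation (inv_ne_zero hb)).2 (by simp; lia)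
      refine conj_smul_intOrder ?_ ?_ <;> intro i j <;> fin_cases i <;> fin_cases j <;>
        simp [shearUnit, hv, hv.neg, inPow_one, InPow.zero]
    · have : gap ⟨0, 0⟩ ⟨a, b⟩ = a - 2 * b.valuation := by
        rw [gap, conf_eq (c := b.valuation)]
        · simp
        · intro k
          have : InPow k (0 - b) ↔ k ≤ b.valuation := by
            rw [← inPow_iff_le_valuation hb]
            exact ⟨fun hk => by simpa using hk.neg, fun hk => by simpa using hk.neg⟩
          rw [this]
          exact ⟨fun hk => hk.2.2, fun hk => ⟨by dsimp only; lia, by dsimp only; lia, hk⟩⟩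
      rw [this]
      exact shear_smul_ballOrder hb h.2.le

/-- A matrix in `M₂(ℤ_q)` is in the order of the ball `q ^ n ℤ_q` if and only if its upper right
entry is divisible by `q ^ n`. -/
lemma interIndex_intOrder_ray (n : ℕ) : interIndex (intOrder q) (ballOrder ⟨n, 0⟩) = q ^ n := by
  let e : (Subalgebra.toSubmodule (intOrder q)).toAddSubgroup →+ ℤ_[q] :=
    AddMonoidHom.mk' (fun X => ⟨X.1 0 1, by simpa [InPow] using X.2 0 1⟩) (fun X Y => rfl)
  let f : (Subalgebra.toSubmodule (intOrder q)).toAddSubgroup →+ ZMod (q ^ n) :=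
    (PadicInt.toZModPow n).toAddMonoidHom.comp e
  have hker :
      (Subalgebra.toSubmodule (ballOrder (⟨n, 0⟩ : PadicBall q))).toAddSubgroup.addSubgroupOf
      (Subalgebra.toSubmodule (intOrder q)).toAddSubgroup = f.ker := by
    ext X
    have hX : ∀ i j, InPow 0 (X.1 i j) := X.2
    obtain ⟨s, hs, hfs⟩ : ∃ s : ℤ_[q], (s : ℚ_[q]) = X.1 0 1 ∧ f X = PadicInt.toZModPow n s :=
      ⟨_, rfl, rfl⟩
    rw [AddSubgroup.mem_addSubgroupOf, AddMonoidHom.mem_ker, hfs, ← RingHom.mem_ker,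
      PadicInt.ker_toZModPow, ← PadicInt.norm_le_pow_iff_mem_span_pow, PadicInt.norm_def, hs]
    refine mem_ballOrder.trans ?_
    simp only [zero_mul, sub_zero, add_zero, hX, ne_eq, OfNat.ofNat_ne_zero, not_false_eq_true,
      zero_pow, true_and]
    exact ⟨fun h => h.2, fun h => ⟨(hX 1 0).mono (by simp), h⟩⟩
  have hsurj : Function.Surjective f := by
    intro t
    obtain ⟨s, rfl⟩ := ZMod.ringHom_surjective (PadicInt.toZModPow (p := q) n) t
    refine ⟨⟨!![0, s; 0, 0], ?_⟩, rfl⟩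
    intro i j
    fin_cases i <;> fin_cases j <;> simp [InPow.zero, inPow_coe]
  rw [interIndex, AddSubgroup.relIndex, hker, AddSubgroup.index_ker,
    AddMonoidHom.range_eq_top.2 hsurj]
  simp

lemma interIndex_ballOrder (p p' : PadicBall q) :
    interIndex (ballOrder p) (ballOrder p') = q ^ (gap p p').toNat := by
  have h : (affConj p)⁻¹ • ballOrder p = intOrder q := inv_smul_smul _ _
  rw [← interIndex_conj_smul (affConj p)⁻¹, h, affConj_inv_smul_ballOrder]
  obtain ⟨g, hg, hg'⟩ := exists_smul_ballOrder_eq_ray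
    ⟨p'.exp - p.exp, (q : ℚ_[q]) ^ (-p.exp) * (p'.ctr - p.ctr)⟩
  rw [← interIndex_conj_smul g, hg, hg', gap_relative, ← interIndex_intOrder_ray,
    Int.toNat_of_nonneg (gap_nonneg p p')]

lemma adj_ballVertex_iff {p p' : PadicBall q} :
    (bruhatTits q).Adj (ballVertex p) (ballVertex p') ↔ gap p p' = 1 := by
  have hq := (Fact.out : q.Prime).one_lt
  change interIndex (ballOrder p) (ballOrder p') = q ∧
    interIndex (ballOrder p') (ballOrder p) = q ↔ _
  rw [interIndex_ballOrder, interIndex_ballOrder, gap_comm p' p, and_self]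
  rw [Nat.pow_eq_self_iff hq]
  have := gap_nonneg p p'
  lia

end Cartan

/-! ### Graph distance and neighborhoods -/

section Distance

variable {q : ℕ} [Fact q.Prime]

lemma gap_eq_of_pow_eq {p p' : PadicBall q} {m : ℕ} (h : q ^ (gap p p').toNat = q ^ m) :
    gap p p' = m := by
  have := Nat.pow_right_injective (Fact.out : q.Prime).two_le h
  have := gap_nonneg p p'
  lia

lemma gap_eq_zero_of_ballVertex_eq {p p' : PadicBall q} (h : ballVertex p = ballVertex p') :
    gap p p' = 0 := by
  refine gap_eq_of_pow_eq (m := 0) ?_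
  rw [← interIndex_ballOrder, ← show ballOrder p = ballOrder p' from congrArg Subtype.val h]
  exact AddSubgroup.relIndex_self _

/-- Conjugation preserves the relative position of vertices. -/
lemma gap_eq_of_smul {g : ConjGL q} {p₁ p₂ p₁' p₂' : PadicBall q}
    (h₁ : g • ballVertex p₁ = ballVertex p₁') (h₂ : g • ballVertex p₂ = ballVertex p₂') :
    gap p₁' p₂' = gap p₁ p₂ := by
  have h₁' : g • ballOrder p₁ = ballOrder p₁' := congrArg Subtype.val h₁
  have h₂' : g • ballOrder p₂ = ballOrder p₂' := congrArg Subtype.val h₂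
  rw [← Int.toNat_of_nonneg (gap_nonneg p₁ p₂)]
  refine gap_eq_of_pow_eq ?_
  rw [← interIndex_ballOrder, ← interIndex_ballOrder, ← h₁', ← h₂', interIndex_conj_smul]

lemma gap_le_length {x y : MaxOrder q} (w : (bruhatTits q).Walk x y) :
    ∀ p p', x = ballVertex p → y = ballVertex p' → gap p p' ≤ w.length := by
  induction w with
  | nil =>
    rintro p p' rfl h
    simp [gap_eq_zero_of_ballVertex_eq h]
  | @cons x z y hxz w ih =>
    rintro p p' rfl rfl
    obtain ⟨p'', rfl⟩ := exists_eq_ballVertex z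
    have h1 := ih p'' p' rfl rfl
    have h2 := adj_ballVertex_iff.1 hxz
    have := gap_triangle p p'' p'
    rw [SimpleGraph.Walk.length_cons]
    push_cast
    lia

/-- Enlarging the ball `p` by one step brings it closer to every ball that it does not contain. -/
lemma edist_le_of_conf_lt {p p' : PadicBall q} (h : conf p p' < p.exp) {n : ℕ}
    (ih : ∀ r r' : PadicBall q, gap r r' ≤ n →
      (bruhatTits q).edist (ballVertex r) (ballVertex r') ≤ n)
    (hn : gap p p' ≤ n + 1) :
    (bruhatTits q).edist (ballVertex p) (ballVertex p') ≤ (n + 1 : ℕ) := by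
  have h1 : conf p ⟨p.exp - 1, p.ctr⟩ = p.exp - 1 :=
    conf_eq fun k => ⟨fun hk => hk.2.1, fun hk => ⟨by lia, hk, by simpa using InPow.zero k⟩⟩
  have h2 : conf p p' ≤ conf ⟨p.exp - 1, p.ctr⟩ p' :=
    le_conf_iff.2 ⟨by dsimp only; lia, conf_le_right _ _,
      ((le_conf_iff (p := p) (p' := p')).1 le_rfl).2.2⟩
  have hadj : (bruhatTits q).Adj (ballVertex p) (ballVertex ⟨p.exp - 1, p.ctr⟩) := by
    rw [adj_ballVertex_iff, gap, h1]; ring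
  have hle := ih ⟨p.exp - 1, p.ctr⟩ p' (by simp only [gap] at hn ⊢; lia)
  calc _ ≤ (bruhatTits q).edist (ballVertex p) (ballVertex ⟨p.exp - 1, p.ctr⟩) +
        (bruhatTits q).edist (ballVertex ⟨p.exp - 1, p.ctr⟩) (ballVertex p') :=
        SimpleGraph.edist_triangle
    _ ≤ 1 + n := add_le_add (SimpleGraph.edist_eq_one_iff_adj.2 hadj).le hle
    _ = (n + 1 : ℕ) := by push_cast; ring

lemma edist_le_of_gap_le (n : ℕ) : ∀ p p' : PadicBall q, gap p p' ≤ n →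
    (bruhatTits q).edist (ballVertex p) (ballVertex p') ≤ n := by
  induction n with
  | zero =>
    intro p p' h
    rw [ballVertex_eq_of_gap_eq_zero (le_antisymm h (gap_nonneg p p')), SimpleGraph.edist_self]
    rfl
  | succ n ih =>
    intro p p' h
    push_cast at h
    by_cases h1 : conf p p' < p.exp
    · exact edist_le_of_conf_lt h1 ih h
    by_cases h2 : conf p' p < p'.exp
    · rw [SimpleGraph.edist_comm]
      exact edist_le_of_conf_lt h2 ih (gap_comm p p' ▸ h)
    -- Each ball contains the other, so they coincide.
    · refine (ih p p' ?_).trans (by simp)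
      rw [conf_comm] at h2
      simp only [gap]; lia

lemma edist_ballVertex_le_iff {p p' : PadicBall q} {n : ℕ} :
    (bruhatTits q).edist (ballVertex p) (ballVertex p') ≤ n ↔ gap p p' ≤ n := by
  refine ⟨fun h => ?_, edist_le_of_gap_le n p p'⟩
  obtain ⟨w, hw⟩ := SimpleGraph.exists_walk_of_edist_ne_top (ne_top_of_le_ne_top (by simp) h)
  rw [← hw, Nat.cast_le] at h
  exact (gap_le_length w p p' rfl rfl).trans (by exact_mod_cast h)

lemma mem_nbhd_iff {V : Type*} {G : SimpleGraph V} {ℓ : ℕ} {P : Set V} {x : V} :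
    x ∈ nbhd G ℓ P ↔ ∃ y ∈ P, G.edist x y ≤ ℓ := by
  simp only [nbhd, distToSet, Set.mem_ofPred_eq]
  rw [← ENat.lt_add_one_iff (by simp)]
  simp only [iInf_lt_iff, exists_prop]
  simp only [ENat.lt_add_one_iff (ENat.natCast_ne_top ℓ)]

lemma edist_conj_smul_le_iff (g : ConjGL q) (x y : MaxOrder q) {n : ℕ} :
    (bruhatTits q).edist (g • x) (g • y) ≤ n ↔ (bruhatTits q).edist x y ≤ n := by
  obtain ⟨p, rfl⟩ := exists_eq_ballVertex x
  obtain ⟨p', rfl⟩ := exists_eq_ballVertex y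
  obtain ⟨r, hr⟩ := exists_eq_ballVertex (g • ballVertex p)
  obtain ⟨r', hr'⟩ := exists_eq_ballVertex (g • ballVertex p')
  rw [hr, hr', edist_ballVertex_le_iff, edist_ballVertex_le_iff, gap_eq_of_smul hr hr']

lemma nbhd_conj_smul (g : ConjGL q) (ℓ : ℕ) (P : Set (MaxOrder q)) :
    nbhd (bruhatTits q) ℓ (g • P) = g • nbhd (bruhatTits q) ℓ P := by
  ext x
  rw [Set.mem_smul_set_iff_inv_smul_mem, mem_nbhd_iff, mem_nbhd_iff]
  constructor
  · rintro ⟨_, ⟨y, hy, rfl⟩, h⟩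
    refine ⟨y, hy, ?_⟩
    rwa [← edist_conj_smul_le_iff g, smul_inv_smul]
  · rintro ⟨y, hy, h⟩
    refine ⟨g • y, Set.smul_mem_smul_set hy, ?_⟩
    rwa [← edist_conj_smul_le_iff g, smul_inv_smul] at h

end Distance

/-! ### Nonbacktracking paths -/

section Paths

variable {q : ℕ} [Fact q.Prime]

/-- Absence of cycles: if one neighbor `y` of `x` is closer to `o`, then every other neighbor `z`
is farther away. -/
lemma gap_succ_of_ne {o x y z : PadicBall q} (hxy : gap x y = 1) (hxz : gap x z = 1)
    (hyz : gap y z ≠ 0) (h : gap o x = gap o y + 1) : gap o z = gap o x + 1 := by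
  -- All ultrametric inequalities between the four balls; the rest is linear arithmetic.
  have u1 := min_conf_le o x y
  have u2 := min_conf_le o y x
  have u4 := min_conf_le o x z
  have u5 := min_conf_le o z x
  have u7 := min_conf_le o y z
  have u8 := min_conf_le o z y
  have u9 := min_conf_le y o z
  have u10 := min_conf_le y x z
  rw [conf_comm y x] at *
  rw [conf_comm z x] at *
  rw [conf_comm z y] at *
  rw [conf_comm y o] at *
  have := conf_le_right o x
  have := conf_le_right o y
  have := conf_le_right o z
  have := conf_le_left x y
  have := conf_le_right x y
  have := conf_le_left x z
  have := conf_le_right x z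
  have := conf_le_left y z
  have := conf_le_right y z
  simp only [gap] at *
  omega

/-- The first `n + 1` vertices of the standard ray. -/
def raySegment (q : ℕ) [Fact q.Prime] (n : ℕ) : Set (MaxOrder q) :=
  (fun i : ℕ => ballVertex ⟨i, 0⟩) '' Set.Iic n

lemma ncard_raySegment (n : ℕ) : (raySegment q n).ncard = n + 1 := by
  rw [raySegment, Set.ncard_image_of_injective]
  · rw [← Finset.coe_Iic, Set.ncard_coe_finset, Nat.card_Iic]
  · intro i j h
    have h0 := gap_eq_zero_of_ballVertex_eq h
    have h1 := conf_le_left (q := q) ⟨i, 0⟩ ⟨j, 0⟩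
    have h2 := conf_le_right (q := q) ⟨i, 0⟩ ⟨j, 0⟩
    simp only [gap] at h0 h1 h2
    lia

/-- A vertex on a shortest path from `(0, 0)` to `(n, 0)` is on the standard ray. -/
lemma ballVertex_eq_ray {p : PadicBall q} {i n : ℕ} (h0 : gap ⟨0, 0⟩ p ≤ i)
    (hn : gap p ⟨n, 0⟩ ≤ n - i) : ballVertex p = ballVertex ⟨i, 0⟩ := by
  have h1 := conf_le_left ⟨0, 0⟩ p
  have h2 := conf_le_left p ⟨n, 0⟩
  have h3 := ((le_conf_iff (p := p) (p' := ⟨n, 0⟩)).1 le_rfl).2.2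
  simp only [gap] at h0 hn h1
  exact Subtype.ext (ballOrder_congr (by dsimp only; lia) (h3.mono (by lia)))

/-- Every nonbacktracking path is conjugate to a segment of the standard ray. -/
lemma exists_smul_vertexSet_eq {x y : MaxOrder q} (w : (bruhatTits q).Walk x y)
    (hw : IsNonbacktracking w) : ∃ g : ConjGL q, g • vertexSet w = raySegment q w.length := by
  choose b hb using fun i => exists_eq_ballVertex (w.getVert i)
  have hadj {i : ℕ} (hi : i < w.length) : gap (b i) (b (i + 1)) = 1 := by
    rw [← adj_ballVertex_iff, ← hb, ← hb]; exact w.adj_getVert_succ hi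
  have hgeo (i : ℕ) : i + 1 ≤ w.length → gap (b 0) (b i) = i ∧ gap (b 0) (b (i + 1)) = i + 1 := by
    induction i with
    | zero => exact fun hi =>
      ⟨by simpa using gap_eq_zero_of_ballVertex_eq rfl, by simpa using hadj hi⟩
    | succ i ih =>
      intro hi
      obtain ⟨h1, h2⟩ := ih (by lia)
      refine ⟨by exact_mod_cast h2, ?_⟩
      have := gap_succ_of_ne (o := b 0) (x := b (i + 1)) (y := b i) (z := b (i + 2))
        (by rw [gap_comm]; exact hadj (by lia)) (hadj (by lia))
        (fun h => hw i hi (by rw [hb, hb, ballVertex_eq_of_gap_eq_zero h])) (by lia)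
      push_cast
      lia
  have hlen : gap (b 0) (b w.length) = w.length := by
    rcases Nat.eq_zero_or_pos w.length with h | h
    · rw [h]; exact gap_eq_zero_of_ballVertex_eq rfl
    · obtain ⟨m, hm⟩ := Nat.exists_eq_add_of_lt h
      have := (hgeo m (by lia)).2
      rw [hm]; push_cast
      simpa using this
  have hle (i j : ℕ) : i + j ≤ w.length → gap (b i) (b (i + j)) ≤ j := by
    induction j with
    | zero => exact fun _ => (gap_eq_zero_of_ballVertex_eq rfl).le
    | succ j ih =>
      intro hj
      have := ih (by lia)
      have := hadj (i := i + j) (by lia)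
      have := gap_triangle (b i) (b (i + j)) (b (i + j + 1))
      rw [← add_assoc]
      push_cast
      lia
  -- Move the start to `M₂(ℤ_q)` by an affine map, then the end onto the standard ray.
  obtain ⟨g, hg, hg'⟩ := exists_smul_ballOrder_eq_ray
    ⟨(b w.length).exp - (b 0).exp,
      (q : ℚ_[q]) ^ (-(b 0).exp) * ((b w.length).ctr - (b 0).ctr)⟩
  rw [gap_relative, ← affConj_inv_smul_ballOrder, hlen, ← mul_smul] at hg'
  have hstart : (g * (affConj (b 0))⁻¹) • ballVertex (b 0) = ballVertex ⟨0, 0⟩ := by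
    refine Subtype.ext ?_
    change (g * (affConj (b 0))⁻¹) • ballOrder (b 0) = ballOrder ⟨0, 0⟩
    rw [ballOrder_zero, mul_smul, ballOrder, inv_smul_smul, hg]
  have hend : (g * (affConj (b 0))⁻¹) • ballVertex (b w.length) = ballVertex ⟨w.length, 0⟩ :=
    Subtype.ext hg'
  have hray {i : ℕ} (hi : i ≤ w.length) :
      (g * (affConj (b 0))⁻¹) • w.getVert i = ballVertex ⟨i, 0⟩ := by
    obtain ⟨r, hr⟩ := exists_eq_ballVertex ((g * (affConj (b 0))⁻¹) • w.getVert i)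
    rw [hr]
    rw [hb] at hr
    refine ballVertex_eq_ray (n := w.length) ?_ ?_
    · rw [gap_eq_of_smul hstart hr]
      simpa using hle 0 i (by lia)
    · rw [gap_eq_of_smul hr hend]
      have := hle i (w.length - i) (by lia)
      rw [Nat.add_sub_cancel' hi] at this
      lia
  refine ⟨g * (affConj (b 0))⁻¹, Set.ext fun v => ?_⟩
  constructor
  · rintro ⟨u, hu, rfl⟩
    obtain ⟨i, rfl, hi⟩ := SimpleGraph.Walk.mem_support_iff_exists_getVert.1 hu
    exact ⟨i, hi, (hray hi).symm⟩
  · rintro ⟨i, hi, rfl⟩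
    exact ⟨w.getVert i, w.getVert_mem_support i, hray hi⟩

end Paths

/-! ### The intersection over a neighborhood of a ray segment -/

section Neighborhood

variable {q : ℕ} [Fact q.Prime]

lemma ballVertex_mem_nbhd_iff {p : PadicBall q} {ℓ n : ℕ} :
    ballVertex p ∈ nbhd (bruhatTits q) ℓ (raySegment q n) ↔ ∃ i ≤ n, gap p ⟨i, 0⟩ ≤ ℓ := by
  simp [mem_nbhd_iff, raySegment, edist_ballVertex_le_iff]

lemma mem_interOrders {S : Set (MaxOrder q)} {X : MatQ q} :
    X ∈ interOrders S ↔ ∀ Λ ∈ S, X ∈ Λ.1 := by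
  simp only [interOrders, Algebra.mem_iInf]

lemma mem_interOrders_nbhd_ray {ℓ n : ℕ} {X : MatQ q} :
    X ∈ interOrders (nbhd (bruhatTits q) ℓ (raySegment q n)) ↔
      InPow 0 (X 1 1) ∧ InPow ℓ (X 0 0 - X 1 1) ∧ InPow ℓ (X 1 0) ∧ InPow (n + ℓ) (X 0 1) := by
  rw [mem_interOrders]
  constructor
  -- Three balls at distance `ℓ` from the segment suffice: the two on the extension of the segment in
  -- both directions, and one that branches off at its start; the last one makes the diagonal entries
  -- congruent modulo `q ^ ℓ`.
  · intro h
    have hmem {p : PadicBall q} (i : ℕ) (hi : i ≤ n) (c : ℤ)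
        (hc : c ≤ p.exp ∧ c ≤ i ∧ InPow c p.ctr)
        (hℓ : p.exp + i - 2 * c ≤ ℓ) : X ∈ ballOrder p := by
      refine h (ballVertex p) (ballVertex_mem_nbhd_iff.2 ⟨i, hi, ?_⟩)
      have := (le_conf_iff (p := p) (p' := ⟨i, 0⟩) (k := c)).2 (by simpa using hc)
      rw [gap]; lia
    have h1 := mem_ballOrder.1 (hmem (p := ⟨-ℓ, 0⟩) 0 (Nat.zero_le n) (-ℓ)
      ⟨le_rfl, by simp, InPow.zero _⟩ (by push_cast; lia))
    have h2 := mem_ballOrder.1 (hmem (p := ⟨n + ℓ, 0⟩) n le_rfl n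
      ⟨by simp, le_rfl, InPow.zero _⟩ (by dsimp only; lia))
    have h3 := mem_ballOrder.1 (hmem (p := ⟨ℓ, 1⟩) 0 (Nat.zero_le n) 0
      ⟨by simp, le_rfl, inPow_one⟩ (by simp))
    simp only [zero_mul, sub_zero, add_zero, neg_neg, ne_eq, OfNat.ofNat_ne_zero, not_false_eq_true,
      zero_pow, one_mul, one_pow] at h1 h2 h3
    refine ⟨h1.2.1, ?_, h1.2.2.1, h2.2.2.2⟩
    convert (h3.2.2.2.sub (h2.2.2.2.mono (by lia))).add h1.2.2.1 using 1
    ring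
  · rintro ⟨h1, h2, h3, h4⟩ Λ hΛ
    obtain ⟨p, rfl⟩ := exists_eq_ballVertex Λ
    obtain ⟨i, hi, hgap⟩ := ballVertex_mem_nbhd_iff.1 hΛ
    obtain ⟨hc1, hc2, hc3⟩ := (le_conf_iff (p := p) (p' := ⟨i, 0⟩)).1 le_rfl
    rw [gap] at hgap
    set c := conf p ⟨i, 0⟩
    dsimp only at hc2 hc3 hgap
    rw [sub_zero] at hc3
    have h5 : InPow 0 (p.ctr * X 1 0) := hc3.mul_of_le h3 (by lia)
    refine mem_ballOrder.2 ⟨?_, h1.add h5, h3.mono (by lia), ?_⟩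
    · convert ((h2.mono (by lia)).add h1).sub h5 using 1
      ring
    · rw [pow_two]
      exact ((h4.mono (by lia)).add (hc3.mul_of_le h2 (by lia))).sub
        ((hc3.mul hc3).mul_of_le h3 (by lia))

/-- Three scaled matrix units in the intersection bound the balls whose orders contain it. -/
lemma mem_nbhd_of_interOrders_le {ℓ n : ℕ} {p : PadicBall q}
    (h : interOrders (nbhd (bruhatTits q) ℓ (raySegment q n)) ≤ ballOrder p) :
    ballVertex p ∈ nbhd (bruhatTits q) ℓ (raySegment q n) := by
  have h1 : !![(q : ℚ_[q]) ^ ℓ, 0; 0, 0] ∈ ballOrder p :=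
    h (mem_interOrders_nbhd_ray.2 (by simp [InPow.zero, inPow_pow_iff]))
  have h2 : !![0, (q : ℚ_[q]) ^ (n + ℓ); 0, 0] ∈ ballOrder p :=
    h (mem_interOrders_nbhd_ray.2 (by simp [InPow.zero, inPow_pow_iff]))
  have h3 : !![0, 0; (q : ℚ_[q]) ^ ℓ, 0] ∈ ballOrder p :=
    h (mem_interOrders_nbhd_ray.2 (by simp [InPow.zero, inPow_pow_iff]))
  simp only [mem_ballOrder, Matrix.of_apply, Matrix.cons_val', Matrix.cons_val_zero,
    Matrix.cons_val_one, Matrix.cons_val_fin_one, mul_zero, sub_zero, add_zero, zero_add, zero_sub,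
    inPow_pow_iff, inPow_mul_pow_iff] at h1 h2 h3
  obtain ⟨-, -, -, h1⟩ := h1
  obtain ⟨-, -, -, h2⟩ := h2
  obtain ⟨-, h3, h4, h5⟩ := h3
  replace h5 : InPow (p.exp - ℓ) (p.ctr ^ 2) := inPow_mul_pow_iff.1 (by simpa using h5.neg)
  -- `c` is the exponent of the smallest ball that contains `p` and `0`.
  obtain ⟨c, hc0, hc1, hc2, hc3, hc4⟩ : ∃ c : ℤ, InPow c p.ctr ∧ c ≤ p.exp ∧ p.exp - ℓ ≤ c ∧
      -ℓ ≤ c ∧ p.exp - ℓ ≤ 2 * c := by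
    by_cases hb : p.ctr = 0
    · exact ⟨p.exp, hb ▸ InPow.zero _, le_rfl, by lia, by lia, by lia⟩
    · rw [inPow_iff_le_valuation hb] at h1 h3
      rw [inPow_iff_le_valuation (pow_ne_zero 2 hb), Padic.valuation_pow] at h5
      refine ⟨min p.exp p.ctr.valuation, (inPow_iff_le_valuation hb).2 (min_le_right _ _),
        min_le_left _ _, ?_, ?_, ?_⟩ <;> push_cast at * <;> lia
  have hgap (i : ℕ) (d : ℤ) (hdc : d ≤ c) (hdi : d ≤ i) : gap p ⟨i, 0⟩ ≤ p.exp + i - 2 * d := by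
    have := (le_conf_iff (p := p) (p' := ⟨i, 0⟩) (k := d)).2
      ⟨hdc.trans hc1, hdi, by simpa using hc0.mono hdc⟩
    rw [gap]; lia
  rw [ballVertex_mem_nbhd_iff]
  -- The vertex of the segment closest to `p` is `c`, clamped to the range from `0` to `n`.
  rcases lt_or_ge c 0 with hc | hc
  · exact ⟨0, Nat.zero_le n, (hgap 0 c le_rfl (by lia)).trans (by lia)⟩
  rcases le_total c n with hcn | hcn
  · refine ⟨c.toNat, by lia, (hgap c.toNat c le_rfl (by lia)).trans (by lia)⟩
  · exact ⟨n, le_rfl, (hgap n n hcn le_rfl).trans (by lia)⟩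

lemma setOf_interOrders_le (ℓ n : ℕ) :
    {Λ : MaxOrder q | interOrders (nbhd (bruhatTits q) ℓ (raySegment q n)) ≤ Λ.1} =
      nbhd (bruhatTits q) ℓ (raySegment q n) := by
  ext Λ
  constructor
  · obtain ⟨p, rfl⟩ := exists_eq_ballVertex Λ
    exact mem_nbhd_of_interOrders_le
  · exact fun hΛ X hX => mem_interOrders.1 hX Λ hΛ

end Neighborhood

/-! ### The reduced discriminant -/

section Discriminant

variable {q : ℕ} [Fact q.Prime]

/-- The discriminant can be computed from one basis: the determinant changes by the square of the
determinant of the transition matrix. -/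
lemma discIdeal_eq_span {Λ : Subalgebra ℤ_[q] (MatQ q)} (β : Module.Basis (Fin 4) ℤ_[q] Λ)
    {d : ℤ_[q]} (hd : (d : ℚ_[q]) = (Matrix.of fun i j : Fin 4 =>
      Matrix.trace ((β i : MatQ q) * (β j : MatQ q))).det) : discIdeal Λ = Ideal.span {d} := by
  refine le_antisymm (Ideal.span_le.2 ?_) (Ideal.span_mono (by simpa using ⟨β, hd⟩))
  rintro d' ⟨γ, hd'⟩
  have hcoe (x : ℤ_[q]) : PadicInt.Coe.ringHom x = (x : ℚ_[q]) := rfl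
  let A : Matrix (Fin 4) (Fin 4) ℤ_[q] := Matrix.of fun i j => β.repr (γ i) j
  have hγ (i : Fin 4) : (γ i : MatQ q) = ∑ j, (A i j : ℚ_[q]) • (β j : MatQ q) := by
    have := congrArg (Subalgebra.val Λ) (β.sum_repr (γ i)).symm
    rw [map_sum] at this
    exact this
  have hgram : (Matrix.of fun i j : Fin 4 => Matrix.trace ((γ i : MatQ q) * (γ j : MatQ q))) =
      (PadicInt.Coe.ringHom.mapMatrix A) * (Matrix.of fun i j : Fin 4 =>
        Matrix.trace ((β i : MatQ q) * (β j : MatQ q))) *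
        (PadicInt.Coe.ringHom.mapMatrix A).transpose := by
    ext i j
    simp only [Matrix.of_apply, hγ, Matrix.mul_apply, Matrix.transpose_apply, Finset.sum_mul,
      Finset.mul_sum, Matrix.trace_sum, Matrix.smul_mul, Matrix.mul_smul, Matrix.trace_smul,
      smul_eq_mul]
    refine Finset.sum_congr rfl fun k _ => Finset.sum_congr rfl fun l _ => ?_
    simp only [RingHom.mapMatrix_apply, Matrix.map_apply, hcoe]
    ring
  rw [hgram, Matrix.det_mul, Matrix.det_mul, Matrix.det_transpose, ← hd, ← RingHom.map_det] at hd'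
  rw [SetLike.mem_coe, Ideal.mem_span_singleton]
  refine ⟨A.det * A.det, ?_⟩
  refine Subtype.ext ?_
  rw [hd']
  push_cast
  simp only [hcoe]
  ring

lemma discrd_eq_of_sq {Λ : Subalgebra ℤ_[q] (MatQ q)} {J : Ideal ℤ_[q]} (h : discIdeal Λ = J ^ 2) :
    discrd Λ = J := by
  have : {I : Ideal ℤ_[q] | I ^ 2 = discIdeal Λ} = {J} := by
    ext I
    rw [Set.mem_ofPred_eq, Set.mem_singleton_iff, h]
    refine ⟨fun hI => le_antisymm ?_ ?_, fun hI => hI ▸ rfl⟩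
    · exact Ideal.dvd_iff_le.1
        ((UniqueFactorizationMonoid.pow_dvd_pow_iff_dvd two_ne_zero).1 hI.symm.dvd)
    · exact Ideal.dvd_iff_le.1
        ((UniqueFactorizationMonoid.pow_dvd_pow_iff_dvd two_ne_zero).1 hI.dvd)
  rw [discrd, this, sSup_singleton]

lemma idealVal_span_pow (m : ℕ) : idealVal (Ideal.span {(q : ℤ_[q]) ^ m}) = m := by
  rw [idealVal, ← Ideal.span_singleton_pow]
  refine emultiplicity_pow_self ?_ ?_ m
  · simpa using (Fact.out : q.Prime).ne_zero
  · rw [Ideal.isUnit_iff, Ideal.span_singleton_eq_top]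
    exact PadicInt.prime_p.not_isUnit

/-- The combination with coefficients `t` of the matrices `1`, `q ^ ℓ E₀₀`, `q ^ ℓ E₁₀` and
`q ^ (n + ℓ) E₀₁`. -/
noncomputable def unitCombination (q : ℕ) [Fact q.Prime] (ℓ n : ℕ) :
    (Fin 4 → ℤ_[q]) →ₗ[ℤ_[q]] MatQ q where
  toFun t := !![(t 0 : ℚ_[q]) + t 1 * (q : ℚ_[q]) ^ ℓ, t 3 * (q : ℚ_[q]) ^ (n + ℓ);
    t 2 * (q : ℚ_[q]) ^ ℓ, t 0]
  map_add' s t := by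
    ext i j
    fin_cases i <;> fin_cases j <;> simp <;> ring
  map_smul' c t := by
    ext i j
    rw [RingHom.id_apply, padicInt_smul_apply]
    fin_cases i <;> fin_cases j <;> simp <;> ring

lemma unitCombination_apply (ℓ n : ℕ) (t : Fin 4 → ℤ_[q]) : unitCombination q ℓ n t =
    !![(t 0 : ℚ_[q]) + t 1 * (q : ℚ_[q]) ^ ℓ, t 3 * (q : ℚ_[q]) ^ (n + ℓ);
      t 2 * (q : ℚ_[q]) ^ ℓ, t 0] := rfl

lemma unitCombination_injective (ℓ n : ℕ) : Function.Injective (unitCombination q ℓ n) := by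
  rw [← LinearMap.ker_eq_bot, LinearMap.ker_eq_bot']
  intro t ht
  rw [unitCombination_apply] at ht
  have h11 := congrFun (congrFun ht 1) 1
  have h00 := congrFun (congrFun ht 0) 0
  have h10 := congrFun (congrFun ht 1) 0
  have h01 := congrFun (congrFun ht 0) 1
  simp at h11
  simp [h11, (Fact.out : q.Prime).ne_zero] at h00 h10 h01
  ext i
  fin_cases i <;> simp [*]

lemma range_unitCombination (ℓ n : ℕ) : LinearMap.range (unitCombination q ℓ n) =
    Subalgebra.toSubmodule (interOrders (nbhd (bruhatTits q) ℓ (raySegment q n))) := by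
  ext X
  rw [Subalgebra.mem_toSubmodule, mem_interOrders_nbhd_ray]
  constructor
  · rintro ⟨t, rfl⟩
    have hz (m : ℕ) (t : ℤ_[q]) : InPow m ((t : ℚ_[q]) * (q : ℚ_[q]) ^ m) := by
      rw [inPow_mul_pow_iff, sub_self]; exact inPow_coe t
    rw [unitCombination_apply]
    exact ⟨by simpa using inPow_coe _, by simpa using hz ℓ _, by simpa using hz ℓ _,
      by simpa using hz (n + ℓ) _⟩
  · rintro ⟨h1, h2, h3, h4⟩
    rw [← Nat.cast_add] at h4
    obtain ⟨t0, h1⟩ := inPow_zero_iff.1 h1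
    obtain ⟨t1, h2⟩ := exists_coe_mul_pow h2
    obtain ⟨t2, h3⟩ := exists_coe_mul_pow h3
    obtain ⟨t3, h4⟩ := exists_coe_mul_pow h4
    refine ⟨![t0, t1, t2, t3], ?_⟩
    rw [unitCombination_apply, Matrix.eta_fin_two X]
    simp [h1, ← h2, ← h3, ← h4]

lemma exists_basis_interOrders (ℓ n : ℕ) :
    ∃ β : Module.Basis (Fin 4) ℤ_[q] (interOrders (nbhd (bruhatTits q) ℓ (raySegment q n))),
      ∀ i, (β i : MatQ q) = unitCombination q ℓ n (Pi.single i 1) :=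
  ⟨Module.Basis.ofEquivFun ((LinearEquiv.ofInjective _ (unitCombination_injective ℓ n)).trans
    (LinearEquiv.ofEq _ _ (range_unitCombination ℓ n))).symm, fun i => by
      rw [Module.Basis.coe_ofEquivFun]; rfl⟩

lemma discIdeal_interOrders (ℓ n : ℕ) :
    discIdeal (interOrders (nbhd (bruhatTits q) ℓ (raySegment q n))) =
      Ideal.span {(q : ℤ_[q]) ^ (3 * ℓ + n)} ^ 2 := by
  obtain ⟨β, hβ⟩ := exists_basis_interOrders (q := q) ℓ n
  have hgram : (Matrix.of fun i j : Fin 4 => Matrix.trace ((β i : MatQ q) * (β j : MatQ q))) =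
      !![2, (q : ℚ_[q]) ^ ℓ, 0, 0; (q : ℚ_[q]) ^ ℓ, (q : ℚ_[q]) ^ ℓ * (q : ℚ_[q]) ^ ℓ, 0, 0;
        0, 0, 0, (q : ℚ_[q]) ^ ℓ * (q : ℚ_[q]) ^ (n + ℓ);
        0, 0, (q : ℚ_[q]) ^ (n + ℓ) * (q : ℚ_[q]) ^ ℓ, 0] := by
    ext i j
    rw [Matrix.of_apply, hβ, hβ, unitCombination_apply, unitCombination_apply]
    fin_cases i <;> fin_cases j <;> (simp [Matrix.trace_fin_two]; try norm_num)
  rw [discIdeal_eq_span β (d := -((q : ℤ_[q]) ^ (3 * ℓ + n)) ^ 2), Ideal.span_singleton_pow,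
    Ideal.span_singleton_neg]
  rw [hgram]
  simp [Matrix.det_succ_row_zero, Fin.sum_univ_succ, Fin.succAbove]
  ring

end Discriminant

theorem corollary3 (q : ℕ) [Fact q.Prime] {Λ₁ Λ₂ : MaxOrder q}
    (p : (bruhatTits q).Walk Λ₁ Λ₂) (hp : IsNonbacktracking p) (ℓ : ℕ) :
    {Λ : MaxOrder q | interOrders (nbhd (bruhatTits q) ℓ (vertexSet p)) ≤ Λ.1} =
        nbhd (bruhatTits q) ℓ (vertexSet p) ∧
      idealVal (discrd (interOrders (nbhd (bruhatTits q) ℓ (vertexSet p)))) =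
        ((3 * ℓ + (vertexSet p).ncard - 1 : ℕ) : ℕ∞) := by
  obtain ⟨g, hg⟩ := exists_smul_vertexSet_eq p hp
  have hR : g • interOrders (nbhd (bruhatTits q) ℓ (vertexSet p)) =
      interOrders (nbhd (bruhatTits q) ℓ (raySegment q p.length)) := by
    rw [← hg, nbhd_conj_smul, interOrders_conj_smul]
  constructor
  · ext Λ
    have h := Set.ext_iff.1 (setOf_interOrders_le (q := q) ℓ p.length) (g • Λ)
    rw [Set.mem_ofPred_eq, ← hR, coe_conj_smul, conj_smul_le_conj_smul, ← hg, nbhd_conj_smul,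
      Set.smul_mem_smul_set_iff] at h
    exact h
  · have hcard : (vertexSet p).ncard = p.length + 1 := by
      rw [← ncard_raySegment (q := q), ← hg, Set.ncard_smul_set]
    rw [← discrd_conj_smul g, hR, discrd_eq_of_sq (discIdeal_interOrders ℓ p.length),
      idealVal_span_pow, hcard]
    rfl
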